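/- Let $n \ge 2$ and $1 \le r \le n$, and let $X_r$ be the graph in the binary Hamming scheme $\mathcal{H}(n,2)$ whose vertices are the binary words of length $n$, two words being adjacent if and only if their Hamming distance is $r$. For a graph $X$ with adjacency matrix $A$ put $U(t) = e^{-\mathrm{i}tA}$. We say that $X$ has balanced fractional revival at time $\tau > 0$ if there are $\alpha, \beta \in \mathbb{C}$ with $|\alpha| = |\beta| = 1/\sqrt{2}$ such that for every vertex $a$ there is a vertex $b \ne a$ with $U(\tau)\mathbf{e}_a = \alpha \mathbf{e}_a + \beta \mathbf{e}_b$. For a positive integer $m$, let $\alpha_2(m)$ be the largest $k$ such that $2^k$ divides $m$, and let $(m)_2$ be the binary representation of $m$, with positions counted from $0$ starting at the least significant digit. **Proposition.** $X_r$ is a connected graph with balanced fractional revival at time $\pi/4$ if and only if the following hold: (i) $n$ is odd, and $n-1$ is not a power of $2$; (ii) $(r-1)_2$ is obtained from $(n-1)_2$ by replacing some (at least one) $1$'s with $0$'s, where the $1$ at position $\alpha_2(n-1)$ is not replaced. **Corollary.** For every $n \equiv 3 \pmod 4$, the graph $X_3$ in $\mathcal{H}(n,2)$ has balanced fractional revival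 at time $\pi/4$ (connectedness of $X_3$ is not asserted). -/

import Mathlib

namespace HammingFR

/-- The transition matrix `U(t) = exp(-i t A(G))` of the continuous-time quantum walk on `G`. -/
noncomputable def transitionMatrix {V : Type*} [Fintype V] [DecidableEq V]
    (G : SimpleGraph V) [DecidableRel G.Adj] (t : ℝ) : Matrix V V ℂ :=
  NormedSpace.exp ((-(Complex.I * (t : ℂ))) • G.adjMatrix ℂ)

/-- `(α, β)`-revival occurs in `G` from `a` to `b` at time `τ > 0`:
`U(τ) e_a = α e_a + β e_b`, with `a ≠ b`, `β ≠ 0` and `|α|² + |β|² = 1`. -/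
def RevivalFromTo {V : Type*} [Fintype V] [DecidableEq V]
    (G : SimpleGraph V) [DecidableRel G.Adj] (α β : ℂ) (τ : ℝ) (a b : V) : Prop :=
  0 < τ ∧ a ≠ b ∧ β ≠ 0 ∧ ‖α‖ ^ 2 + ‖β‖ ^ 2 = 1 ∧
    (transitionMatrix G τ).mulVec (Pi.single a 1) =
      α • (Pi.single a 1 : V → ℂ) + β • (Pi.single b 1 : V → ℂ)

/-- `G` has `(α, β)`-revival at time `τ`: it has it from every vertex. -/
def HasRevival {V : Type*} [Fintype V] [DecidableEq V]
    (G : SimpleGraph V) [DecidableRel G.Adj] (α β : ℂ) (τ : ℝ) : Prop :=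
  ∀ a : V, ∃ b : V, RevivalFromTo G α β τ a b

/-- `G` has balanced fractional revival at time `τ`. -/
def HasBalancedRevival {V : Type*} [Fintype V] [DecidableEq V]
    (G : SimpleGraph V) [DecidableRel G.Adj] (τ : ℝ) : Prop :=
  ∃ α β : ℂ, HasRevival G α β τ ∧ ‖α‖ = 1 / Real.sqrt 2 ∧ ‖β‖ = 1 / Real.sqrt 2

/-- The graph `X_r` of the binary Hamming scheme `H(n,2)`: binary words of length `n`, two words
being adjacent when their Hamming distance is `r` (used for `1 ≤ r`; the condition `x ≠ y`
only matters for `r = 0`, where it removes the loops). -/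
def distanceGraph (n r : ℕ) : SimpleGraph (Fin n → ZMod 2) where
  Adj x y := x ≠ y ∧ hammingDist x y = r
  symm := ⟨fun x y h => ⟨h.1.symm, by rw [hammingDist_comm]; exact h.2⟩⟩
  loopless := ⟨fun _ h => h.1 rfl⟩

instance (n r : ℕ) : DecidableRel (distanceGraph n r).Adj :=
  fun x y => inferInstanceAs (Decidable (x ≠ y ∧ hammingDist x y = r))

/-- The binary expansion of `k` is obtained from that of `m` by replacing some (at least one)
1s by 0s, but not the 1 at position `p`. Positions are counted from 0, least significant first;
`S` is the set of positions at which a 1 is replaced. -/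
def ObtainedByClearingOnes (m k p : ℕ) : Prop :=
  ∃ S : Finset ℕ, S.Nonempty ∧ (∀ i ∈ S, m.testBit i = true ∧ i ≠ p) ∧
    ∀ i : ℕ, k.testBit i = true ↔ (m.testBit i = true ∧ i ∉ S)

end HammingFR

namespace HammingFR

open Polynomial Finset

/-! ### Binary digits and parity of binomial coefficients -/

/-! The Walsh characters diagonalise `X_r`; on a character of weight `s` the eigenvalue is `K_s`,
the coefficient of `X^r` in `(1 - X)^s (1 + X)^(n - s)`. Revival from `0` to `b` says that each
phase `exp(-iπK/4)` equals `α + β χ(b)`. All weight-one phases agree, which forces `b` to be the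
all-ones word, so the condition becomes: the phase of `K_s` is `α + β (-1)^s` for all `s`.

The phase has period 8 in the eigenvalue; adding 4 negates it and adding 2 multiplies it by `-i`.
Now `K_0 - K_1 = 2 C(n-1, r-1)`, while `K_s - K_(s+2)` is four times a Krawtchouk number congruent
mod 2 to `C(n-2, r-1)`. Hence balanced revival holds iff `C(n-1, r-1)` is odd and `C(n-2, r-1)` is
even (`hasBalancedRevival_pi_div_four_iff`). By Lucas, this says that the digits of `r-1` lie among
those of `n-1` and include its lowest 1. Connectedness means `r` odd and `r ≠ n`
(`distanceGraph_connected_iff`), which supplies the remaining conditions. -/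

theorem odd_choose_iff_testBit (m k : ℕ) :
    Odd (m.choose k) ↔ ∀ i, k.testBit i = true → m.testBit i = true := by
  induction m using Nat.strong_induction_on generalizing k with
  | _ m ih =>
    rcases Nat.eq_zero_or_pos m with rfl | hm
    · rcases Nat.eq_zero_or_pos k with rfl | hk
      · simp
      · obtain ⟨i, hi⟩ := Nat.exists_testBit_of_ne_zero hk.ne'
        rw [Nat.choose_eq_zero_of_lt hk]
        simp only [Nat.zero_testBit, Bool.false_eq_true, imp_false]
        exact ⟨fun h => absurd h (by decide), fun h => absurd hi (h i)⟩
    · have : Fact (Nat.Prime 2) := ⟨Nat.prime_two⟩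
      have hl := Choose.choose_modEq_choose_mod_mul_choose_div_nat (n := m) (k := k) (p := 2)
      have hbits : (∀ i, k.testBit i = true → m.testBit i = true) ↔
          ((k % 2 = 1 → m % 2 = 1) ∧
            ∀ i, (k / 2).testBit i = true → (m / 2).testBit i = true) := by
        constructor
        · intro h
          refine ⟨by simpa using h 0, fun i => ?_⟩
          simpa only [Nat.testBit_succ] using h (i + 1)
        · rintro ⟨h0, h⟩ (_ | i)
          · simpa using h0
          · simpa only [Nat.testBit_succ] using h i
      rw [hbits, ← ih (m / 2) (by omega), Nat.odd_iff, hl, ← Nat.odd_iff, Nat.odd_mul]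
      refine and_congr_left fun _ => ?_
      rcases Nat.mod_two_eq_zero_or_one m with h1 | h1 <;>
        rcases Nat.mod_two_eq_zero_or_one k with h2 | h2 <;> simp [h1, h2]

/-- Writing `m = 2^p (2c + 1)`, subtracting 1 borrows through the trailing zeros: the digits up to
`p` flip and the higher ones stay. -/
theorem testBit_pred_eq {m : ℕ} (hm : m ≠ 0) (i : ℕ) :
    (m.testBit i = (if i < padicValNat 2 m then false else
      if i = padicValNat 2 m then true else m.testBit i)) ∧
    ((m - 1).testBit i = (if i < padicValNat 2 m then true else
      if i = padicValNat 2 m then false else m.testBit i)) := by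
  obtain ⟨p, q, hq, rfl⟩ := Nat.exists_eq_two_pow_mul_odd hm
  have hp : padicValNat 2 (2 ^ p * q) = p := by
    have : Fact (Nat.Prime 2) := ⟨Nat.prime_two⟩
    rw [padicValNat.mul (by positivity) hq.pos.ne', padicValNat.prime_pow,
      padicValNat.eq_zero_of_not_dvd hq.not_two_dvd_nat, add_zero]
  obtain ⟨c, rfl⟩ := hq
  have hpos : 0 < 2 ^ p := by positivity
  have h1 : 2 ^ p * (2 * c + 1) - 1 = 2 ^ p * (2 * c) + (2 ^ p - 1) := by
    rw [mul_add]; omega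
  rw [hp, h1, Nat.testBit_two_pow_mul_add _ (by omega), Nat.testBit_two_pow_mul]
  rcases lt_trichotomy i p with h | rfl | h
  · simp [h]
  · simp
  · obtain ⟨d, rfl⟩ := Nat.exists_eq_add_of_lt h
    have : p + d + 1 - p = d + 1 := by omega
    simp [this, Nat.testBit_succ, show ¬ (p + d + 1 < p) by omega,
      show ¬ (p + d + 1 = p) by omega, show p ≤ p + d + 1 by omega,
      show (2 * c + 1) / 2 = c by omega]

/-- The only 1 of `m` missing from `m - 1` is the lowest one. -/
theorem odd_choose_and_even_choose_pred_iff {m : ℕ} (hm : m ≠ 0) (k : ℕ) :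
    (Odd (m.choose k) ∧ Even ((m - 1).choose k)) ↔
      ((∀ i, k.testBit i = true → m.testBit i = true) ∧
        k.testBit (padicValNat 2 m) = true) := by
  rw [← Nat.not_odd_iff_even, odd_choose_iff_testBit, odd_choose_iff_testBit]
  refine and_congr_right fun hk => ⟨fun h => ?_, fun h h' => ?_⟩
  · by_contra hp
    refine h fun i hi => ?_
    have hmi := hk i hi
    rw [(testBit_pred_eq hm i).2]
    rcases lt_trichotomy i (padicValNat 2 m) with h1 | h1 | h1
    · simp [h1]
    · exact absurd (h1 ▸ hi) hp
    · simp [h1.not_gt, h1.ne', hmi]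
  · have := h' _ h
    rw [(testBit_pred_eq hm _).2] at this
    simp at this

theorem testBit_padicValNat_two_self {m : ℕ} (hm : m ≠ 0) :
    m.testBit (padicValNat 2 m) = true := by
  rw [(testBit_pred_eq hm _).1]; simp

theorem obtainedByClearingOnes_iff {m k p : ℕ} (hp : m.testBit p = true) :
    ObtainedByClearingOnes m k p ↔
      (∀ i, k.testBit i = true → m.testBit i = true) ∧ k.testBit p = true ∧ k ≠ m := by
  constructor
  · rintro ⟨S, ⟨j, hj⟩, hS, h⟩
    refine ⟨fun i hi => ((h i).1 hi).1, (h p).2 ⟨hp, fun hpS => (hS p hpS).2 rfl⟩, ?_⟩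
    rintro rfl
    exact ((h j).1 (hS j hj).1).2 hj
  · rintro ⟨h, hkp, hne⟩
    obtain ⟨j, hj⟩ := Nat.exists_testBit_ne_of_ne hne
    -- Every 1 of `m` is at a position `i < 2^i ≤ m`, so `range m` loses nothing.
    have key : ∀ i, i ∈ (range m).filter
        (fun i => m.testBit i = true ∧ ¬ k.testBit i = true) ↔
        (m.testBit i = true ∧ ¬ k.testBit i = true) := fun i => by
      rw [mem_filter, mem_range, and_iff_right_iff_imp]
      exact fun hi => Nat.lt_two_pow_self.trans_le (Nat.ge_two_pow_of_testBit hi.1)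
    refine ⟨_, ⟨j, (key j).2 ?_⟩, fun i hi => ?_, fun i => ?_⟩
    · have := h j
      cases hm : m.testBit j <;> cases hk : k.testBit j <;> simp_all
    · rw [key] at hi
      exact ⟨hi.1, fun e => hi.2 (e ▸ hkp)⟩
    · rw [key]
      have := h i
      tauto

/-! ### Krawtchouk numbers -/

/-- The value at `s` of the Krawtchouk polynomial of degree `r` for words of length `s + t`. -/
noncomputable def krawtchouk (s t r : ℕ) : ℤ :=
  (((1 : ℤ[X]) - X) ^ s * (1 + X) ^ t).coeff r

theorem krawtchouk_zero_left (t r : ℕ) : krawtchouk 0 t r = (t.choose r : ℤ) := by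
  rw [krawtchouk, pow_zero, one_mul, coeff_one_add_X_pow]

/-- From `(1 + X) - (1 - X) = 2X`. -/
theorem krawtchouk_sub_krawtchouk_one (t r : ℕ) :
    krawtchouk 0 (t + 1) (r + 1) - krawtchouk 1 t (r + 1) = 2 * t.choose r := by
  have h : (2 : ℤ) * t.choose r = (((1 : ℤ[X]) + X) ^ t * X * C 2).coeff (r + 1) := by
    rw [coeff_mul_C, coeff_mul_X, coeff_one_add_X_pow, mul_comm]
  rw [h, krawtchouk, krawtchouk, ← coeff_sub]
  congr 1
  simp only [map_ofNat]
  ring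

/-- From `(1 + X)^2 - (1 - X)^2 = 4X`. -/
theorem krawtchouk_sub_krawtchouk_add_two (s t r : ℕ) :
    krawtchouk s (t + 2) (r + 1) - krawtchouk (s + 2) t (r + 1) = 4 * krawtchouk s t r := by
  have h : 4 * krawtchouk s t r =
      (((1 : ℤ[X]) - X) ^ s * (1 + X) ^ t * X * C 4).coeff (r + 1) := by
    rw [coeff_mul_C, coeff_mul_X, krawtchouk, mul_comm]
  rw [h, krawtchouk, krawtchouk, ← coeff_sub]
  congr 1
  simp only [map_ofNat]
  ring

/-- Modulo 2 the factors `1 - X` and `1 + X` coincide. -/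
theorem even_krawtchouk_iff (s t r : ℕ) :
    Even (krawtchouk s t r) ↔ Even ((s + t).choose r) := by
  have h : ((krawtchouk s t r : ℤ) : ZMod 2) = (((s + t).choose r : ℕ) : ZMod 2) := by
    have h1 : (((1 : ℤ[X]) - X) ^ s * (1 + X) ^ t).map (Int.castRingHom (ZMod 2)) =
        (1 + X) ^ (s + t) := by
      simp only [Polynomial.map_mul, Polynomial.map_pow, Polynomial.map_sub,
        Polynomial.map_add, Polynomial.map_one, Polynomial.map_X, CharTwo.sub_eq_add, pow_add]
    rw [← coeff_one_add_X_pow, ← h1, coeff_map, krawtchouk]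
    rfl
  rw [← ZMod.intCast_eq_zero_iff_even, h, ZMod.natCast_eq_zero_iff_even]

end HammingFR

namespace HammingFR

open Finset

/-! ### Connectedness -/

theorem distanceGraph_adj_iff {n r : ℕ} (hr : r ≠ 0) (x y : Fin n → ZMod 2) :
    (distanceGraph n r).Adj x y ↔ hammingNorm (x - y) = r := by
  change (x ≠ y ∧ hammingDist x y = r) ↔ _
  rw [hammingDist_comm, hammingDist_eq_hammingNorm, neg_add_eq_sub, and_iff_right_iff_imp]
  rintro h rfl
  simp at h
  exact hr h.symm

/-- Such an `f` is constant along edges, hence on components. -/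
theorem not_connected_of_additive_invariant {n r : ℕ} (hr : r ≠ 0)
    (f : (Fin n → ZMod 2) →+ ZMod 2) (hf : ∀ v, hammingNorm v = r → f v = 0)
    (w : Fin n → ZMod 2) (hw : f w ≠ 0) : ¬ (distanceGraph n r).Connected := by
  intro hc
  have key : ∀ x y, (distanceGraph n r).Reachable x y → f x = f y := by
    rintro x y ⟨p⟩
    induction p with
    | nil => rfl
    | cons h _ ih =>
      rw [← ih, ← sub_eq_zero, ← map_sub]
      exact hf _ ((distanceGraph_adj_iff hr _ _).1 h)
  exact hw ((key w 0 (hc.preconnected w 0)).trans (map_zero f))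

theorem not_connected_of_even {n r : ℕ} (hn : 2 ≤ n) (hr : r ≠ 0) (h : Even r) :
    ¬ (distanceGraph n r).Connected := by
  have hz : ∀ c : ZMod 2, c = if c ≠ 0 then 1 else 0 := by decide
  refine not_connected_of_additive_invariant hr
    (∑ i, Pi.evalAddMonoidHom (fun _ : Fin n => ZMod 2) i) (fun v hv => ?_)
    (Pi.single ⟨0, by omega⟩ 1) ?_
  · rw [AddMonoidHom.finsetSum_apply]
    simp only [Pi.evalAddMonoidHom_apply]
    rw [sum_congr rfl fun i _ => hz (v i), sum_boole]
    change ((hammingNorm v : ℕ) : ZMod 2) = 0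
    rw [hv, ZMod.natCast_eq_zero_iff_even]
    exact h
  · rw [AddMonoidHom.finsetSum_apply]
    simp

theorem eq_one_of_hammingNorm_eq {n : ℕ} {v : Fin n → ZMod 2} (hv : hammingNorm v = n)
    (i : Fin n) : v i = 1 := by
  have hz : ∀ c : ZMod 2, c ≠ 0 → c = 1 := by decide
  have h : (univ.filter fun i => v i ≠ 0) = univ := by
    rw [← card_eq_iff_eq_univ, Fintype.card_fin]
    exact hv
  exact hz _ (mem_filter.1 (h.symm ▸ mem_univ i :
    i ∈ univ.filter fun i => v i ≠ 0)).2

/-- An edge flips every coordinate, so the sum of the first two is invariant. -/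
theorem not_connected_of_eq {n : ℕ} (hn : 2 ≤ n) : ¬ (distanceGraph n n).Connected := by
  refine not_connected_of_additive_invariant (by omega)
    (Pi.evalAddMonoidHom (fun _ : Fin n => ZMod 2) ⟨0, by omega⟩ +
      Pi.evalAddMonoidHom (fun _ : Fin n => ZMod 2) ⟨1, by omega⟩)
    (fun v hv => ?_) (Pi.single ⟨0, by omega⟩ 1) ?_
  · simp only [AddMonoidHom.add_apply, Pi.evalAddMonoidHom_apply, eq_one_of_hammingNorm_eq hv]
    decide
  · simp

/-- The indicator word of a set of positions. -/
def indicatorWord {n : ℕ} (S : Finset (Fin n)) : Fin n → ZMod 2 := fun i => if i ∈ S then 1 else 0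

theorem hammingNorm_indicatorWord {n : ℕ} (S : Finset (Fin n)) :
    hammingNorm (indicatorWord S) = S.card := by
  simp [hammingNorm, indicatorWord]

theorem indicatorWord_eq_sum {n : ℕ} (S : Finset (Fin n)) :
    indicatorWord S = ∑ i ∈ S, Pi.single i (1 : ZMod 2) := by
  ext j
  simp [indicatorWord, Finset.sum_apply, Pi.single_apply]

/-- The translations that preserve the connected components of `distanceGraph n r`. -/
def componentStabilizer (n r : ℕ) : AddSubgroup (Fin n → ZMod 2) where
  carrier := {v | ∀ x, (distanceGraph n r).Reachable x (x + v)}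
  zero_mem' := fun x => by rw [add_zero]
  add_mem' := fun {v w} hv hw x => by
    rw [← add_assoc]
    exact (hv x).trans (hw _)
  neg_mem' := fun {v} hv x => by
    have := (hv (x + -v)).symm
    rwa [neg_add_cancel_right] at this

theorem connected_of_odd_of_lt {n r : ℕ} (hr : Odd r) (hrn : r < n) :
    (distanceGraph n r).Connected := by
  have hr0 : r ≠ 0 := hr.pos.ne'
  set R := componentStabilizer n r with hR
  have hS : ∀ S : Finset (Fin n), S.card = r → indicatorWord S ∈ R := fun S h x =>
    (SimpleGraph.Adj.reachable ((distanceGraph_adj_iff hr0 _ _).2 (by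
      rw [add_sub_cancel_left, hammingNorm_indicatorWord, h]))).symm
  have hdiff : ∀ i j : Fin n, Pi.single i (1 : ZMod 2) - Pi.single j 1 ∈ R := by
    intro i j
    rcases eq_or_ne i j with rfl | hij
    · rw [sub_self]; exact R.zero_mem
    -- Two weight-`r` words sharing `r - 1` positions differ by `e_i - e_j`; finding room for them
    -- uses `r < n`.
    obtain ⟨T, hT, hTc⟩ := exists_subset_card_eq (s := ((univ.erase i).erase j)) (n := r - 1) (by
      rw [card_erase_of_mem (by simp [hij.symm]), card_erase_of_mem (by simp), card_univ,
        Fintype.card_fin]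
      omega)
    have hi : i ∉ T := fun h => by simpa using hT h
    have hj : j ∉ T := fun h => by simpa using hT h
    have h := R.sub_mem (hS (insert i T) (by rw [card_insert_of_notMem hi]; omega))
      (hS (insert j T) (by rw [card_insert_of_notMem hj]; omega))
    rwa [indicatorWord_eq_sum, indicatorWord_eq_sum, sum_insert hi, sum_insert hj,
      add_sub_add_right_eq_sub] at h
  have hsingle : ∀ i : Fin n, Pi.single i (1 : ZMod 2) ∈ R := by
    intro i
    obtain ⟨S, -, hSc⟩ := exists_subset_card_eq (s := (univ : Finset (Fin n))) (n := r) (by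
      rw [card_univ, Fintype.card_fin]; omega)
    -- Moving all of `S` onto `i` gives `r • e_i`, which is `e_i` because `r` is odd.
    have h := R.sub_mem (hS S hSc) (R.sum_mem fun j (_ : j ∈ S) => hdiff j i)
    rw [indicatorWord_eq_sum, sum_sub_distrib, sub_sub_cancel, sum_const, hSc] at h
    have h2 : r • (Pi.single i (1 : ZMod 2) : Fin n → ZMod 2) = Pi.single i 1 := by
      rw [← Pi.single_smul, nsmul_one, (ZMod.natCast_eq_one_iff_odd).2 hr]
    rwa [h2] at h
  have hall : ∀ v, v ∈ R := by
    intro v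
    rw [← univ_sum_single v]
    refine R.sum_mem fun i _ => ?_
    have hz : ∀ c : ZMod 2, c = 0 ∨ c = 1 := by decide
    rcases hz (v i) with h | h <;> rw [h]
    · rw [Pi.single_zero]; exact R.zero_mem
    · exact hsingle i
  have : Nonempty (Fin n → ZMod 2) := ⟨0⟩
  refine SimpleGraph.Connected.mk fun x y => ?_
  have := hall (y - x) x
  rwa [add_sub_cancel] at this

theorem distanceGraph_connected_iff {n r : ℕ} (hn : 2 ≤ n) (hr : 1 ≤ r) (hrn : r ≤ n) :
    (distanceGraph n r).Connected ↔ Odd r ∧ r ≠ n := by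
  refine ⟨fun h => ⟨?_, ?_⟩, fun h => connected_of_odd_of_lt h.1 (lt_of_le_of_ne hrn h.2)⟩
  · by_contra ho
    exact not_connected_of_even hn (by omega) (Nat.not_odd_iff_even.1 ho) h
  · rintro rfl
    exact not_connected_of_eq hn h

end HammingFR

namespace HammingFR

open Finset Polynomial

/-! ### Characters of the Hamming scheme -/

/-- The nontrivial character of `ZMod 2`. -/
def signChar (c : ZMod 2) : ℤ := if c = 0 then 1 else -1

theorem signChar_add : ∀ a b : ZMod 2, signChar (a + b) = signChar a * signChar b := by decide

/-- The character of `(ZMod 2)ⁿ` indexed by `y`. -/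
def walsh {n : ℕ} (y x : Fin n → ZMod 2) : ℤ := ∏ i, signChar (y i * x i)

theorem walsh_add {n : ℕ} (y x z : Fin n → ZMod 2) :
    walsh y (x + z) = walsh y x * walsh y z := by
  simp only [walsh, Pi.add_apply, mul_add, signChar_add, prod_mul_distrib]

theorem walsh_comm {n : ℕ} (y x : Fin n → ZMod 2) : walsh y x = walsh x y := by
  simp only [walsh, mul_comm]

theorem walsh_zero {n : ℕ} (y : Fin n → ZMod 2) : walsh y 0 = 1 := by
  simp [walsh, signChar]

theorem walsh_single {n : ℕ} (i : Fin n) (x : Fin n → ZMod 2) :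
    walsh (Pi.single i 1) x = signChar (x i) := by
  rw [walsh, prod_eq_single i]
  · simp
  · intro j _ hj
    simp [hj, signChar]
  · simp

theorem walsh_one {n : ℕ} (y : Fin n → ZMod 2) : walsh y 1 = (-1) ^ hammingNorm y := by
  simp [walsh, signChar, hammingNorm, prod_ite]

theorem sum_walsh {n : ℕ} (y : Fin n → ZMod 2) :
    ∑ x, walsh y x = if y = 0 then 2 ^ n else 0 := by
  have h : ∑ x, walsh y x = ∏ i, ∑ c : ZMod 2, signChar (y i * c) := by
    rw [Finset.prod_univ_sum, Fintype.piFinset_univ]; rfl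
  have h2 : ∀ d : ZMod 2, ∑ c : ZMod 2, signChar (d * c) = if d = 0 then 2 else 0 := by decide
  rw [h]
  simp only [h2]
  split_ifs with hy
  · subst hy; simp
  · obtain ⟨i, hi⟩ := Function.ne_iff.1 hy
    exact prod_eq_zero (mem_univ i) (if_neg hi)

/-- The weight enumerator twisted by a character factors over coordinates, with factor `1 - X` where
`y i ≠ 0` and `1 + X` elsewhere. -/
theorem sum_walsh_hammingNorm {n : ℕ} (y : Fin n → ZMod 2) (r : ℕ) :
    ∑ z, (if hammingNorm z = r then walsh y z else 0) =
      krawtchouk (hammingNorm y) (n - hammingNorm y) r := by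
  have h : ∑ z, C (walsh y z) * (X : ℤ[X]) ^ hammingNorm z =
      (1 - X) ^ hammingNorm y * (1 + X) ^ (n - hammingNorm y) := by
    have h1 : ∀ z : Fin n → ZMod 2, C (walsh y z) * (X : ℤ[X]) ^ hammingNorm z =
        ∏ i, (C (signChar (y i * z i)) * if z i ≠ 0 then X else 1) := fun z => by
      rw [prod_mul_distrib, ← map_prod, walsh, prod_ite, prod_const_one, mul_one, prod_const]
      rfl
    have h2 : ∀ d : ZMod 2, ∑ c : ZMod 2,
        (C (signChar (d * c)) * if c ≠ 0 then (X : ℤ[X]) else 1) =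
          if d ≠ 0 then 1 - X else 1 + X := fun d => by
      have hd : d = 0 ∨ d = 1 := by revert d; decide
      have hu : (univ : Finset (ZMod 2)) = {0, 1} := by decide
      rcases hd with rfl | rfl <;> rw [hu, sum_pair (by decide)] <;>
        simp [signChar, sub_eq_add_neg]
    simp only [h1]
    rw [← Fintype.piFinset_univ, ← Finset.prod_univ_sum (fun _ : Fin n => univ)
      (fun i c => C (signChar (y i * c)) * if c ≠ 0 then (X : ℤ[X]) else 1)]
    simp only [h2]
    rw [prod_ite, prod_const, prod_const]
    congr 2
    have := card_filter_add_card_filter_not (s := (univ : Finset (Fin n))) (fun i => y i ≠ 0)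
    rw [card_univ, Fintype.card_fin] at this
    change _ = n - #{i | y i ≠ 0}
    omega
  rw [krawtchouk, ← h, finsetSum_coeff]
  refine sum_congr rfl fun z _ => ?_
  rw [coeff_C_mul, coeff_X_pow, mul_ite, mul_one, mul_zero]
  simp only [eq_comm]

/-- The character table of `(ZMod 2)ⁿ`. -/
def walshMatrix (n : ℕ) : Matrix (Fin n → ZMod 2) (Fin n → ZMod 2) ℂ :=
  Matrix.of fun y x => (walsh y x : ℂ)

theorem isUnit_walshMatrix (n : ℕ) : IsUnit (walshMatrix n) := by
  have h : walshMatrix n * walshMatrix n = (2 ^ n : ℂ) • 1 := by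
    ext y z
    have : (walshMatrix n * walshMatrix n) y z = ((∑ x, walsh (y + z) x : ℤ) : ℂ) := by
      rw [Matrix.mul_apply, Int.cast_sum]
      refine sum_congr rfl fun x _ => ?_
      rw [walsh_comm (y + z), walsh_add, walsh_comm x y, Int.cast_mul]
      rfl
    have hyz : y + z = 0 ↔ y = z := by
      simp only [funext_iff, Pi.add_apply, Pi.zero_apply, CharTwo.add_eq_zero]
    rw [this, sum_walsh]
    rcases eq_or_ne y z with rfl | hne
    · simp [hyz]
    · simp [hyz, hne]
  refine IsUnit.of_mul_eq_one_right ((2 ^ n : ℂ)⁻¹ • walshMatrix n) ?_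
  rw [Matrix.smul_mul, h, smul_smul, inv_mul_cancel₀ (pow_ne_zero n two_ne_zero), one_smul]

/-- The eigenvalue of `distanceGraph n r` on the character indexed by `y`. -/
noncomputable def eigenvalue {n : ℕ} (r : ℕ) (y : Fin n → ZMod 2) : ℤ :=
  krawtchouk (hammingNorm y) (n - hammingNorm y) r

theorem walshMatrix_mul_adjMatrix {n r : ℕ} (hr : r ≠ 0) :
    walshMatrix n * (distanceGraph n r).adjMatrix ℂ =
      Matrix.diagonal (fun y => (eigenvalue r y : ℂ)) * walshMatrix n := by
  ext y a
  rw [Matrix.diagonal_mul, Matrix.mul_apply, eigenvalue, ← sum_walsh_hammingNorm,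
    Int.cast_sum, sum_mul]
  refine (Equiv.sum_comp (Equiv.addLeft a) _).symm.trans (sum_congr rfl fun z _ => ?_)
  simp only [walshMatrix, Matrix.of_apply, Equiv.coe_addLeft, SimpleGraph.adjMatrix_apply,
    distanceGraph_adj_iff hr, add_sub_cancel_left, walsh_add]
  split_ifs
  · push_cast; ring
  · simp

theorem walshMatrix_mul_transitionMatrix {n r : ℕ} (hr : r ≠ 0) (t : ℝ) :
    walshMatrix n * transitionMatrix (distanceGraph n r) t =
      Matrix.diagonal (fun y => Complex.exp (-(Complex.I * t) * eigenvalue r y)) *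
        walshMatrix n := by
  have hu := isUnit_walshMatrix n
  have hdet := (Matrix.isUnit_iff_isUnit_det _).1 hu
  have hA : (-(Complex.I * (t : ℂ))) • (distanceGraph n r).adjMatrix ℂ =
      (walshMatrix n)⁻¹ * Matrix.diagonal (fun y => -(Complex.I * t) * (eigenvalue r y : ℂ)) *
        walshMatrix n := by
    have h2 : Matrix.diagonal (fun y : Fin n → ZMod 2 =>
        -(Complex.I * t) * (eigenvalue r y : ℂ)) =
        (-(Complex.I * (t : ℂ))) • Matrix.diagonal (fun y => (eigenvalue r y : ℂ)) := by
      rw [← Matrix.diagonal_smul]; rfl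
    rw [h2, Matrix.mul_smul, Matrix.smul_mul, mul_assoc, ← walshMatrix_mul_adjMatrix hr,
      Matrix.nonsing_inv_mul_cancel_left _ _ hdet]
  rw [transitionMatrix, hA, Matrix.exp_conj' _ _ hu, Matrix.exp_diagonal, ← mul_assoc, ← mul_assoc,
    Matrix.mul_nonsing_inv _ hdet, one_mul]
  congr 2
  ext y
  rw [Pi.coe_exp, Complex.exp_eq_exp_ℂ]

theorem transitionMatrix_mulVec_single_eq_iff {n r : ℕ} (hr : r ≠ 0) (t : ℝ) (α β : ℂ)
    (a b : Fin n → ZMod 2) :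
    (transitionMatrix (distanceGraph n r) t).mulVec (Pi.single a 1) =
        α • (Pi.single a 1 : (Fin n → ZMod 2) → ℂ) + β • Pi.single b 1 ↔
      ∀ y, Complex.exp (-(Complex.I * t) * eigenvalue r y) * walsh y a =
        α * walsh y a + β * walsh y b := by
  rw [← (Matrix.mulVec_injective_of_isUnit (isUnit_walshMatrix n)).eq_iff, Matrix.mulVec_mulVec,
    walshMatrix_mul_transitionMatrix hr, Matrix.mulVec_add, Matrix.mulVec_smul,
    Matrix.mulVec_smul, funext_iff]
  refine forall_congr' fun y => ?_
  simp [Matrix.diagonal_mul, walshMatrix, Matrix.col_apply]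

end HammingFR

namespace HammingFR

open Finset

/-! ### Balanced fractional revival at time `π / 4` -/

/-- The phase at time `π / 4` of an eigenvector with eigenvalue `k`. -/
noncomputable def phase (k : ℤ) : ℂ :=
  Complex.exp (-(Complex.I * ((Real.pi / 4 : ℝ) : ℂ)) * k)

theorem phase_ne_zero (k : ℤ) : phase k ≠ 0 := Complex.exp_ne_zero _

theorem norm_phase (k : ℤ) : ‖phase k‖ = 1 := by
  rw [phase, show -(Complex.I * ((Real.pi / 4 : ℝ) : ℂ)) * k =
    ((-(Real.pi / 4) * k : ℝ) : ℂ) * Complex.I by push_cast; ring]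
  exact Complex.norm_exp_ofReal_mul_I _

theorem phase_add_two_mul (k c : ℤ) : phase (k + 2 * c) = (-Complex.I) ^ c * phase k := by
  have h : (-Complex.I) ^ c = Complex.exp (-(Complex.I * ((Real.pi / 4 : ℝ) : ℂ)) * (2 * c)) := by
    rw [← Complex.exp_neg_pi_div_two_mul_I, ← Complex.exp_int_mul]
    congr 1
    push_cast
    ring
  rw [h, phase, phase, ← Complex.exp_add]
  congr 1
  push_cast
  ring

theorem phase_add_four_mul_of_even {c : ℤ} (k : ℤ) (hc : Even c) :
    phase (k + 4 * c) = phase k := by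
  obtain ⟨d, rfl⟩ := hc
  rw [show k + 4 * (d + d) = k + 2 * (4 * d) by ring, phase_add_two_mul, zpow_mul]
  have : (-Complex.I) ^ (4 : ℤ) = 1 := by
    rw [show (4 : ℤ) = (4 : ℕ) by rfl, zpow_natCast, Even.neg_pow (by decide), Complex.I_pow_four]
  rw [this, one_zpow, one_mul]

theorem phase_add_four_mul_of_odd {c : ℤ} (k : ℤ) (hc : Odd c) :
    phase (k + 4 * c) = -phase k := by
  obtain ⟨d, rfl⟩ := hc
  rw [show k + 4 * (2 * d + 1) = (k + 2 * 2) + 4 * (d + d) by ring,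
    phase_add_four_mul_of_even _ ⟨d, rfl⟩, phase_add_two_mul]
  rw [show (2 : ℤ) = (2 : ℕ) by rfl, zpow_natCast, neg_sq, Complex.I_sq, neg_one_mul]

theorem phase_add_two_mul_of_even {c : ℤ} (k : ℤ) (hc : Even c) :
    phase (k + 2 * c) = phase k ∨ phase (k + 2 * c) = -phase k := by
  obtain ⟨d, rfl⟩ := hc
  rw [show k + 2 * (d + d) = k + 4 * d by ring]
  rcases Int.even_or_odd d with h | h
  · exact Or.inl (phase_add_four_mul_of_even k h)
  · exact Or.inr (phase_add_four_mul_of_odd k h)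

theorem phase_add_two_mul_of_odd {c : ℤ} (k : ℤ) (hc : Odd c) :
    phase (k + 2 * c) = Complex.I * phase k ∨ phase (k + 2 * c) = -Complex.I * phase k := by
  obtain ⟨d, rfl⟩ := hc
  have h : phase (k + 2) = -Complex.I * phase k := by
    simpa using phase_add_two_mul k 1
  rw [show k + 2 * (2 * d + 1) = (k + 2) + 2 * (d + d) by ring]
  rcases phase_add_two_mul_of_even (k + 2) (Even.add_self d) with h1 | h1 <;> rw [h1, h]
  · exact Or.inr rfl
  · left; ring

theorem norm_add_div_two_of_eq {z w ε : ℂ} (hw : ‖w‖ = 1) (hz : z = ε * w)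
    (hε : ε = Complex.I ∨ ε = -Complex.I) :
    ‖(z + w) / 2‖ = 1 / Real.sqrt 2 ∧ ‖(z - w) / 2‖ = 1 / Real.sqrt 2 := by
  have key : ∀ a b : ℝ, a ^ 2 = 1 → b ^ 2 = 1 →
      ‖((⟨a, b⟩ : ℂ)) * w / 2‖ = 1 / Real.sqrt 2 := by
    intro a b ha hb
    rw [norm_div, norm_mul, hw, mul_one, Complex.norm_eq_sqrt_sq_add_sq, ha, hb]
    have : Real.sqrt 2 * Real.sqrt 2 = 2 := Real.mul_self_sqrt (by norm_num)
    have h0 : Real.sqrt 2 ≠ 0 := by positivity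
    rw [show (1 + 1 : ℝ) = 2 by norm_num, Complex.norm_ofNat, div_eq_div_iff two_ne_zero h0, this]
    norm_num
  have h : ∀ δ : ℂ, z + δ * w = (ε + δ) * w := fun δ => by rw [hz]; ring
  have h1 := h 1
  have h2 := h (-1)
  rw [one_mul] at h1
  rw [neg_one_mul, ← sub_eq_add_neg] at h2
  rw [h1, h2]
  rcases hε with rfl | rfl
  · rw [show Complex.I + 1 = ⟨1, 1⟩ by apply Complex.ext <;> simp,
      show Complex.I + -1 = ⟨-1, 1⟩ by apply Complex.ext <;> simp]
    exact ⟨key _ _ (by norm_num) (by norm_num), key _ _ (by norm_num) (by norm_num)⟩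
  · rw [show -Complex.I + 1 = ⟨1, -1⟩ by apply Complex.ext <;> simp,
      show -Complex.I + -1 = ⟨-1, -1⟩ by apply Complex.ext <;> simp]
    exact ⟨key _ _ (by norm_num) (by norm_num), key _ _ (by norm_num) (by norm_num)⟩

theorem phase_eigenvalue_of_revival {n r : ℕ} (hr : r ≠ 0) {α β : ℂ} (hβ : β ≠ 0)
    {b : Fin n → ZMod 2} (hb : 0 ≠ b)
    (h : (transitionMatrix (distanceGraph n r) (Real.pi / 4)).mulVec (Pi.single 0 1) =
      α • (Pi.single 0 1 : (Fin n → ZMod 2) → ℂ) + β • Pi.single b 1)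
    {s : ℕ} (hs : s ≤ n) : phase (krawtchouk s (n - s) r) = α + β * (-1) ^ s := by
  have h' : ∀ y : Fin n → ZMod 2, phase (eigenvalue r y) = α + β * walsh y b := fun y => by
    have := (transitionMatrix_mulVec_single_eq_iff hr _ α β 0 b).1 h y
    rwa [walsh_zero, Int.cast_one, mul_one, mul_one] at this
  have hone : ∀ i : Fin n, hammingNorm (Pi.single i (1 : ZMod 2) : Fin n → ZMod 2) = 1 :=
    fun i => by
      have := hammingNorm_indicatorWord {i}
      rwa [indicatorWord_eq_sum, sum_singleton, card_singleton] at this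
  obtain ⟨i, hi⟩ := Function.ne_iff.1 hb
  -- Weight-one characters share an eigenvalue and `β ≠ 0`, so all coordinates of `b` agree with its
  -- nonzero one.
  have hb1 : b = 1 := by
    ext1 j
    have hij : phase (eigenvalue r (Pi.single i 1 : Fin n → ZMod 2)) =
        phase (eigenvalue r (Pi.single j 1 : Fin n → ZMod 2)) := by
      rw [eigenvalue, eigenvalue, hone, hone]
    rw [h', h', walsh_single, walsh_single] at hij
    have hij2 : signChar (b i) = signChar (b j) := by
      exact_mod_cast mul_left_cancel₀ hβ (add_left_cancel hij)
    have : ∀ c d : ZMod 2, 0 ≠ c → signChar c = signChar d → d = 1 := by decide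
    exact this _ _ hi hij2
  obtain ⟨S, -, hS⟩ := exists_subset_card_eq (s := (univ : Finset (Fin n))) (n := s) (by
    rwa [card_univ, Fintype.card_fin])
  have h1 := h' (indicatorWord S)
  rw [hb1, walsh_one, eigenvalue, hammingNorm_indicatorWord, hS] at h1
  simpa using h1

theorem phase_krawtchouk_eq {m q : ℕ} {α β : ℂ} (he : Even (m.choose q))
    (h0 : phase (krawtchouk 0 (m + 2) (q + 1)) = α + β)
    (h1 : phase (krawtchouk 1 (m + 1) (q + 1)) = α - β) (s t : ℕ) (hst : s + t = m + 2) :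
    phase (krawtchouk s t (q + 1)) = α + β * (-1) ^ s := by
  induction s using Nat.twoStepInduction generalizing t with
  | zero =>
    obtain rfl : t = m + 2 := by omega
    rw [h0, pow_zero, mul_one]
  | one =>
    obtain rfl : t = m + 1 := by omega
    rw [h1, pow_one]; ring
  | more s ih _ =>
    have h := ih (t + 2) (by omega)
    -- Going from `s` to `s + 2` changes the eigenvalue by a multiple of 8.
    rw [eq_add_of_sub_eq' (krawtchouk_sub_krawtchouk_add_two s t q),
      phase_add_four_mul_of_even _ ((even_krawtchouk_iff s t q).2
        (by rwa [show s + t = m by omega]))] at h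
    rw [h, pow_add, neg_one_sq, mul_one]

theorem hasBalancedRevival_pi_div_four_iff (m q : ℕ) :
    HasBalancedRevival (distanceGraph (m + 2) (q + 1)) (Real.pi / 4) ↔
      Odd ((m + 1).choose q) ∧ Even (m.choose q) := by
  have e01 := eq_add_of_sub_eq' (krawtchouk_sub_krawtchouk_one (m + 1) q)
  have e02 := eq_add_of_sub_eq' (krawtchouk_sub_krawtchouk_add_two 0 m q)
  rw [krawtchouk_zero_left m q] at e02
  constructor
  · rintro ⟨α, β, hrev, hα, hβ⟩
    obtain ⟨b, -, hb, hβ0, -, h⟩ := hrev 0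
    have hα0 : α ≠ 0 := by
      rw [← norm_ne_zero_iff, hα]; positivity
    have hs : ∀ s ≤ m + 2, phase (krawtchouk s (m + 2 - s) (q + 1)) = α + β * (-1) ^ s :=
      fun s hs => phase_eigenvalue_of_revival (Nat.succ_ne_zero q) hβ0 hb h hs
    have h0 : phase (krawtchouk 0 (m + 2) (q + 1)) = α + β := by simpa using hs 0 (by omega)
    have h1 : phase (krawtchouk 1 (m + 1) (q + 1)) = α - β := by
      simpa [sub_eq_add_neg] using hs 1 (by omega)
    have h2 : phase (krawtchouk 2 m (q + 1)) = α + β := by simpa using hs 2 (by omega)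
    constructor
    · by_contra ho
      have he : Even (((m + 1).choose q : ℕ) : ℤ) := by
        exact_mod_cast Nat.not_odd_iff_even.1 ho
      -- Here `α + β = ±(α - β)`, so `α` or `β` would vanish.
      have h3 := phase_add_two_mul_of_even (krawtchouk 1 (m + 1) (q + 1)) he
      rw [← e01, h0, h1] at h3
      rcases h3 with h3 | h3
      · exact hβ0 (by linear_combination h3 / 2)
      · exact hα0 (by linear_combination h3 / 2)
    · by_contra he
      have ho : Odd ((m.choose q : ℕ) : ℤ) := by
        exact_mod_cast Nat.not_even_iff_odd.1 he
      -- Weights 0 and 2 would have opposite phases, yet both equal `α + β`.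
      have h3 := phase_add_four_mul_of_odd (krawtchouk 2 m (q + 1)) ho
      rw [← e02, h0, ← h2] at h3
      exact phase_ne_zero _ (self_eq_neg.1 h3)
  · rintro ⟨ho, he⟩
    set z := phase (krawtchouk 0 (m + 2) (q + 1)) with hz
    set w := phase (krawtchouk 1 (m + 1) (q + 1)) with hw
    have ho' : Odd (((m + 1).choose q : ℕ) : ℤ) := by exact_mod_cast ho
    have hnorm : ‖(z + w) / 2‖ = 1 / Real.sqrt 2 ∧ ‖(z - w) / 2‖ = 1 / Real.sqrt 2 := by
      have h3 := phase_add_two_mul_of_odd (krawtchouk 1 (m + 1) (q + 1)) ho'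
      rw [← e01] at h3
      rcases h3 with h3 | h3
      · exact norm_add_div_two_of_eq (norm_phase _) h3 (Or.inl rfl)
      · exact norm_add_div_two_of_eq (norm_phase _) h3 (Or.inr rfl)
    have hph := phase_krawtchouk_eq (α := (z + w) / 2) (β := (z - w) / 2) he
      (by rw [← hz]; ring) (by rw [← hw]; ring)
    -- These solve `α + β = z`, `α - β = w`; the partner of `a` is its complement.
    refine ⟨(z + w) / 2, (z - w) / 2, fun a => ⟨a + 1, by positivity, ?_, ?_, ?_, ?_⟩,
      hnorm.1, hnorm.2⟩
    · intro h
      have := congrFun (left_eq_add.1 h) 0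
      exact one_ne_zero this
    · rw [← norm_ne_zero_iff, hnorm.2]; positivity
    · rw [hnorm.1, hnorm.2, div_pow, Real.sq_sqrt (by norm_num)]; norm_num
    · rw [transitionMatrix_mulVec_single_eq_iff (Nat.succ_ne_zero q)]
      intro y
      have hy : hammingNorm y ≤ m + 2 := by
        simpa using hammingNorm_le_card_fintype (x := y)
      have := hph (hammingNorm y) (m + 2 - hammingNorm y) (by omega)
      rw [walsh_add, walsh_one]
      change phase (eigenvalue (q + 1) y) * _ = _
      rw [eigenvalue, this]
      push_cast
      ring

end HammingFR

/-! ### From binomial parities to binary digits, and the case `r = 3`. -/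

theorem mainTheorem9 :
    (∀ n r : ℕ, 2 ≤ n → 1 ≤ r → r ≤ n →
      (((HammingFR.distanceGraph n r).Connected ∧
          HammingFR.HasBalancedRevival (HammingFR.distanceGraph n r) (Real.pi / 4)) ↔
        ((Odd n ∧ ¬ ∃ k : ℕ, n - 1 = 2 ^ k) ∧
          HammingFR.ObtainedByClearingOnes (n - 1) (r - 1) (padicValNat 2 (n - 1))))) ∧
    (∀ n : ℕ, n ≡ 3 [MOD 4] →
      HammingFR.HasBalancedRevival (HammingFR.distanceGraph n 3) (Real.pi / 4)) := by
  open HammingFR in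
  constructor
  · intro n r hn hr hrn
    obtain ⟨m, rfl⟩ := Nat.exists_eq_add_of_le' hn
    obtain ⟨q, rfl⟩ := Nat.exists_eq_add_of_le' hr
    have hbits := odd_choose_and_even_choose_pred_iff (Nat.succ_ne_zero m) q
    rw [Nat.succ_eq_add_one, Nat.add_sub_cancel] at hbits
    have hbit := testBit_padicValNat_two_self (Nat.succ_ne_zero m)
    rw [Nat.succ_eq_add_one] at hbit
    rw [distanceGraph_connected_iff hn hr hrn, hasBalancedRevival_pi_div_four_iff, hbits,
      show m + 2 - 1 = m + 1 by omega, Nat.add_sub_cancel, obtainedByClearingOnes_iff hbit]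
    have hm0 : (m + 1).testBit 0 = true ↔ Odd (m + 1) := by simp [Nat.odd_iff]
    have hq0 : q.testBit 0 = true ↔ Odd q := by simp [Nat.odd_iff]
    constructor
    · rintro ⟨⟨hodd, hne⟩, hsub, hp⟩
      refine ⟨⟨?_, ?_⟩, hsub, hp, by omega⟩
      -- If `n - 1` were odd, its lowest 1 would be at position 0, making `r - 1` odd against `r`
      -- odd.
      · by_contra hno
        have hmo : Odd (m + 1) := by
          rw [Nat.odd_iff] at hno ⊢; omega
        rw [padicValNat.eq_zero_of_not_dvd hmo.not_two_dvd_nat, hq0] at hp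
        rw [Nat.odd_iff] at hodd hp; omega
      · rintro ⟨k, hk⟩
        have : Fact (Nat.Prime 2) := ⟨Nat.prime_two⟩
        -- If `n - 1 = 2^k`, keeping its only 1 forces `r = n`.
        rw [hk, padicValNat.prime_pow] at hp
        have := Nat.ge_two_pow_of_testBit hp
        omega
    · rintro ⟨⟨hodd, -⟩, hsub, hp, hne⟩
      refine ⟨⟨?_, by omega⟩, hsub, hp⟩
      -- Digit 0 of `n - 1` is 0, hence so is that of `r - 1`.
      by_contra hno
      have := hm0.1 (hsub 0 (hq0.2 (by rw [Nat.odd_iff] at hno ⊢; omega)))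
      rw [Nat.odd_iff] at hodd this; omega
  · intro n hn
    obtain ⟨c, rfl⟩ : ∃ c, n = 4 * c + 1 + 2 := ⟨n / 4, by unfold Nat.ModEq at hn; omega⟩
    rw [hasBalancedRevival_pi_div_four_iff]
    have h1 : (4 * c + 1).choose 2 = 2 * (c * (4 * c + 1)) := by
      rw [Nat.choose_two_right, Nat.add_sub_cancel]
      exact Nat.div_eq_of_eq_mul_left two_pos (by ring)
    have h2 : (4 * c + 2).choose 2 = 2 * (c * (4 * c + 1)) + (4 * c + 1) := by
      rw [Nat.choose_succ_succ' (4 * c + 1) 1, h1, Nat.choose_one_right, add_comm]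
    rw [h1, show 4 * c + 1 + 1 = 4 * c + 2 by ring, h2]
    exact ⟨by rw [Nat.odd_iff]; omega, even_two_mul _⟩
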